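/- Let $K$ be a field of characteristic zero, $n \ge 0$, $R = K[X_1,\ldots,X_n]$, and let $A_n(K)$ be the $n$-th Weyl algebra, i.e. the $K$-algebra of operators on $R$ generated by multiplication by $X_1,\ldots,X_n$ and by the partial derivatives $\partial_1,\ldots,\partial_n$; thus $R \subseteq A_n(K)$ and $R$ is a left $A_n(K)$-module. For an ideal $L$ of $R$ and an $R$-module $N$ put $\Gamma_L(N)=\{m\in N : L^s m=0 \text{ for some } s\ge 1\}$; if $N$ is an $A_n(K)$-module then $\Gamma_L(N)$ is an $A_n(K)$-submodule. Let $E^\bullet$ be any injective resolution of $R$ by $R$-modules, and let $H^i_L(R) = H^i(\Gamma_L(E^\bullet))$ be the local cohomology modules. For ideals $I,J$ of $R$ the Mayer–Vietoris sequence $$\cdots \to H^{i}_{I+J}(R) \xrightarrow{\rho^i} H^i_I(R) \oplus H^i_J(R) \xrightarrow{\pi^i} H^i_{I\cap J}(R) \xrightarrow{\delta^i} H^{i+1}_{I+J}(R) \to \cdots$$ is the one induced by the short exact sequence of complexes $0 \to \Gamma_{I+J}(E^\bullet) \to \Gamma_I(E^\bullet)\oplus\Gamma_J(E^\bullet) \to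 \Gamma_{I\cap J}(E^\bullet)\to 0$, with maps $x\mapsto (x,x)$ and $(x,y)\mapsto x-y$. Then the Mayer–Vietoris sequence is a sequence of $A_n(K)$-modules. Precisely, all the $H^i_L(R)$ ($L$ an ideal of $R$, $i\ge 0$) carry $A_n(K)$-module structures that extend their $R$-module structures and have the following properties. 1. Let $Q^\bullet$ be any resolution of $R$ by injective left $A_n(K)$-modules. Then there is an $R$-linear chain map $Q^\bullet\to E^\bullet$ lifting the identity of $R$, and for every such chain map, every ideal $L$ and every $i\ge 0$ the induced map $H^i(\Gamma_L(Q^\bullet))\to H^i(\Gamma_L(E^\bullet)) = H^i_L(R)$ is bijective and $A_n(K)$-linear. (So the structure on $H^i_L(R)$ is the one obtained by computing local cohomology in the category of $A_n(K)$-modules, and it is determined by this.) 2. For all ideals $I,J$ of $R$ and all $i\ge 0$ the maps $\rho^i$, $\pi^i$ and the connecting map $\delta^i$ are $A_n(K)$-linear. -/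

import Mathlib

open CategoryTheory

universe u

namespace MVWeyl

/-! ### Torsion functors and local cohomology over a commutative ring -/

section LocalCohomology

variable {R : Type u} [CommRing R]

/-- The `L`-torsion submodule `Γ_L(M) = {m ∈ M | L ^ s m = 0 for some s}`. -/
def torsion (L : Ideal R) (M : Type u) [AddCommGroup M] [Module R M] : Submodule R M where
  carrier := {m | ∃ s : ℕ, ∀ a ∈ L ^ s, a • m = 0}
  zero_mem' := ⟨0, fun a _ => smul_zero a⟩
  add_mem' := by
    rintro x y ⟨s, hs⟩ ⟨t, ht⟩
    refine ⟨s + t, fun a ha => ?_⟩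
    rw [smul_add, hs a (Ideal.pow_le_pow_right (Nat.le_add_right s t) ha),
      ht a (Ideal.pow_le_pow_right (Nat.le_add_left t s) ha), add_zero]
  smul_mem' := by
    rintro r x ⟨s, hs⟩
    exact ⟨s, fun a ha => by rw [smul_comm, hs a ha, smul_zero]⟩

theorem mem_torsion {L : Ideal R} {M : Type u} [AddCommGroup M] [Module R M] {m : M} :
    m ∈ torsion L M ↔ ∃ s : ℕ, ∀ a ∈ L ^ s, a • m = 0 := Iff.rfl

theorem map_mem_torsion (L : Ideal R) {M N : Type u} [AddCommGroup M] [Module R M]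
    [AddCommGroup N] [Module R N] (f : M →ₗ[R] N) {m : M} (hm : m ∈ torsion L M) :
    f m ∈ torsion L N := by
  obtain ⟨s, hs⟩ := hm
  exact ⟨s, fun a ha => by rw [← map_smul, hs a ha, map_zero]⟩

/-- A larger ideal has less torsion. -/
theorem torsion_anti {L L' : Ideal R} (h : L ≤ L') (M : Type u) [AddCommGroup M] [Module R M] :
    torsion L' M ≤ torsion L M := by
  rintro m ⟨s, hs⟩
  exact ⟨s, fun a ha => hs a (Ideal.pow_right_mono h s ha)⟩

theorem torsion_sup (I J : Ideal R) (M : Type u) [AddCommGroup M] [Module R M] {m : M}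
    (h₁ : m ∈ torsion I M) (h₂ : m ∈ torsion J M) : m ∈ torsion (I ⊔ J) M := by
  obtain ⟨s, hs⟩ := h₁
  obtain ⟨t, ht⟩ := h₂
  refine ⟨s + t, fun a ha => ?_⟩
  obtain ⟨b, hb, c, hc, rfl⟩ := Submodule.mem_sup.1 (Ideal.sup_pow_add_le_pow_sup_pow ha)
  rw [add_smul, hs b hb, ht c hc, add_zero]

/-- The functor `Γ_L` on `R`-modules. -/
def torsionFunctor (L : Ideal R) : ModuleCat.{u} R ⥤ ModuleCat.{u} R where
  obj M := ModuleCat.of R (torsion L M)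
  map f := ModuleCat.ofHom (f.hom.restrict fun _ hm => map_mem_torsion L f.hom hm)
  map_id _ := rfl
  map_comp _ _ := rfl

instance (L : Ideal R) : (torsionFunctor L).Additive where
  map_add := rfl

/-- The complex `Γ_L(E)` for a cochain complex `E` of `R`-modules. -/
noncomputable abbrev torsionComplex (L : Ideal R) (E : CochainComplex (ModuleCat.{u} R) ℕ) :
    CochainComplex (ModuleCat.{u} R) ℕ :=
  ((torsionFunctor L).mapHomologicalComplex (ComplexShape.up ℕ)).obj E

/-- The local cohomology module `H^i_L(M)`: the value at `M` of the `i`-th right derived functor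
of `Γ_L`, computed as `H^i(Γ_L(E))` from an injective resolution `E` of `M`. -/
noncomputable abbrev localCoh (L : Ideal R) {M : ModuleCat.{u} R} (E : InjectiveResolution M)
    (i : ℕ) : ModuleCat.{u} R :=
  (torsionComplex L E.cocomplex).homology i

/-! ### The Mayer-Vietoris sequence -/

/-- The inclusion `Γ_{L'} ⟶ Γ_L` for `L ≤ L'`. -/
def torsionIncl {L L' : Ideal R} (h : L ≤ L') : torsionFunctor L' ⟶ torsionFunctor L where
  app M := ModuleCat.ofHom (Submodule.inclusion (torsion_anti h M))
  naturality _ _ _ := rfl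

/-- The functor `M ↦ Γ_I(M) × Γ_J(M)`. -/
def torsionProd (I J : Ideal R) : ModuleCat.{u} R ⥤ ModuleCat.{u} R where
  obj M := ModuleCat.of R (torsion I M × torsion J M)
  map f := ModuleCat.ofHom (((torsionFunctor I).map f).hom.prodMap ((torsionFunctor J).map f).hom)
  map_id _ := rfl
  map_comp _ _ := rfl

instance (I J : Ideal R) : (torsionProd I J).Additive where
  map_add := rfl

/-- `Γ_{I+J}(M) ⟶ Γ_I(M) × Γ_J(M)`, `x ↦ (x, x)`. -/
def mvDiag (I J : Ideal R) : torsionFunctor (I ⊔ J) ⟶ torsionProd I J where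
  app M := ModuleCat.ofHom
    ((Submodule.inclusion (torsion_anti le_sup_left M)).prod
      (Submodule.inclusion (torsion_anti le_sup_right M)))
  naturality _ _ _ := rfl

/-- `Γ_I(M) × Γ_J(M) ⟶ Γ_{I∩J}(M)`, `(x, y) ↦ x - y`. -/
def mvDiff (I J : Ideal R) : torsionProd I J ⟶ torsionFunctor (I ⊓ J) where
  app M := ModuleCat.ofHom
    ((Submodule.inclusion (torsion_anti inf_le_left M)).comp (LinearMap.fst R _ _) -
      (Submodule.inclusion (torsion_anti inf_le_right M)).comp (LinearMap.snd R _ _))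
  naturality M N f := by
    ext x
    apply Subtype.ext
    exact (map_sub f.hom (x.1 : M) (x.2 : M)).symm

theorem mvDiag_mvDiff (I J : Ideal R) (M : ModuleCat.{u} R) :
    (mvDiag I J).app M ≫ (mvDiff I J).app M = 0 := by
  ext x
  apply Subtype.ext
  exact sub_self x.1

/-- The sequence of complexes `Γ_{I+J}(E) ⟶ Γ_I(E) ⊕ Γ_J(E) ⟶ Γ_{I∩J}(E)`. -/
noncomputable def mvShortComplex (I J : Ideal R) (E : CochainComplex (ModuleCat.{u} R) ℕ) :
    ShortComplex (CochainComplex (ModuleCat.{u} R) ℕ) where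
  X₁ := torsionComplex (I ⊔ J) E
  X₂ := ((torsionProd I J).mapHomologicalComplex (ComplexShape.up ℕ)).obj E
  X₃ := torsionComplex (I ⊓ J) E
  f := (NatTrans.mapHomologicalComplex (mvDiag I J) (ComplexShape.up ℕ)).app E
  g := (NatTrans.mapHomologicalComplex (mvDiff I J) (ComplexShape.up ℕ)).app E
  zero := by
    ext1 j
    exact mvDiag_mvDiff I J (E.X j)

/-- `I ^ m ∩ J ^ s ⊆ (I ∩ J) ^ s` for large `m`, by Artin-Rees. -/
theorem exists_pow_inf_pow_le [IsNoetherianRing R] (I J : Ideal R) (s : ℕ) :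
    ∃ m : ℕ, I ^ m ⊓ J ^ s ≤ (I ⊓ J) ^ s := by
  obtain ⟨k, hk⟩ := Ideal.exists_pow_inf_eq_pow_smul I (J ^ s : Submodule R R)
  refine ⟨s + k, ?_⟩
  have h := hk (s + k) (Nat.le_add_left k s)
  rw [Nat.add_sub_cancel] at h
  have h1 : I ^ (s + k) ⊓ J ^ s = I ^ (s + k) • (⊤ : Submodule R R) ⊓ J ^ s := by
    rw [Ideal.smul_eq_mul, Ideal.mul_top]
  have h2 : I ^ s • (I ^ k • (⊤ : Submodule R R) ⊓ J ^ s) ≤ I ^ s * J ^ s :=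
    Ideal.mul_mono_right inf_le_right
  rw [h1, h]
  refine h2.trans ?_
  rw [← mul_pow]
  exact Ideal.pow_right_mono Ideal.mul_le_inf s

/-- For injective `M` over a Noetherian ring, `Γ_{I∩J}(M) = Γ_I(M) + Γ_J(M)`. -/
theorem exists_sub_eq [IsNoetherianRing R] (I J : Ideal R) (M : ModuleCat.{u} R)
    [Injective M] {x : M} (hx : x ∈ torsion (I ⊓ J) M) :
    ∃ y ∈ torsion I M, ∃ z ∈ torsion J M, y - z = x := by
  obtain ⟨s, hs⟩ := hx
  obtain ⟨m, hm⟩ := exists_pow_inf_pow_le I J s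
  let ψ : R →ₗ[R] (R ⧸ I ^ m) × (R ⧸ J ^ s) :=
    (Submodule.mkQ (I ^ m)).prod (Submodule.mkQ (J ^ s))
  have hker : ∀ r, ψ r = 0 ↔ r ∈ I ^ m ⊓ J ^ s := by
    intro r
    simp [ψ, Submodule.mem_inf, Ideal.Quotient.eq_zero_iff_mem]
  let ψ' : (R ⧸ (I ^ m ⊓ J ^ s)) →ₗ[R] (R ⧸ I ^ m) × (R ⧸ J ^ s) :=
    Submodule.liftQ _ ψ fun r hr => (hker r).2 hr
  have hψ' : Function.Injective ψ' := by
    rw [← LinearMap.ker_eq_bot, LinearMap.ker_eq_bot']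
    intro q hq
    obtain ⟨r, rfl⟩ := Submodule.mkQ_surjective _ q
    exact (Submodule.Quotient.mk_eq_zero _).2 ((hker r).1 hq)
  let φ : (R ⧸ (I ^ m ⊓ J ^ s)) →ₗ[R] M :=
    Submodule.liftQ _ (LinearMap.toSpanSingleton R M x) fun r hr => hs r (hm hr)
  have : Mono (ModuleCat.ofHom ψ') := (ModuleCat.mono_iff_injective _).2 hψ'
  let h : ModuleCat.of R ((R ⧸ I ^ m) × (R ⧸ J ^ s)) ⟶ M :=
    Injective.factorThru (ModuleCat.ofHom φ) (ModuleCat.ofHom ψ')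
  have hh : ModuleCat.ofHom ψ' ≫ h = ModuleCat.ofHom φ := Injective.comp_factorThru _ _
  have hx1 : h.hom (Submodule.mkQ (I ^ m) 1, Submodule.mkQ (J ^ s) 1) = x := by
    have := congrArg (fun f => f.hom (Submodule.mkQ (I ^ m ⊓ J ^ s) 1)) hh
    refine Eq.trans this ?_
    exact one_smul R x
  refine ⟨h.hom (Submodule.mkQ (I ^ m) 1, 0), ⟨m, fun a ha => ?_⟩,
    h.hom (0, -Submodule.mkQ (J ^ s) 1), ⟨s, fun a ha => ?_⟩, ?_⟩
  · rw [← map_smul, Prod.smul_mk, smul_zero, ← map_smul, smul_eq_mul, mul_one]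
    have : Submodule.mkQ (I ^ m) a = 0 := (Submodule.Quotient.mk_eq_zero _).2 ha
    rw [this]
    exact map_zero h.hom
  · rw [← map_smul, Prod.smul_mk, smul_zero, smul_neg, ← map_smul, smul_eq_mul, mul_one]
    have : Submodule.mkQ (J ^ s) a = 0 := (Submodule.Quotient.mk_eq_zero _).2 ha
    rw [this, neg_zero]
    exact map_zero h.hom
  · rw [← map_sub, Prod.mk_sub_mk, sub_zero, zero_sub, neg_neg, hx1]

/-- For a complex of injective modules over a Noetherian ring, the sequence
`0 ⟶ Γ_{I+J}(E) ⟶ Γ_I(E) ⊕ Γ_J(E) ⟶ Γ_{I∩J}(E) ⟶ 0` is exact. -/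
theorem mvShortComplex_shortExact [IsNoetherianRing R] (I J : Ideal R)
    (E : CochainComplex (ModuleCat.{u} R) ℕ) (hE : ∀ j, Injective (E.X j)) :
    (mvShortComplex I J E).ShortExact := by
  refine HomologicalComplex.shortExact_of_degreewise_shortExact _ fun j => ?_
  have := hE j
  refine ShortComplex.ShortExact.mk' ?_ ?_ ?_
  · rw [ShortComplex.moduleCat_exact_iff]
    rintro ⟨y, z⟩ h
    have hyz : (y : E.X j) = z := sub_eq_zero.1 (congrArg Subtype.val h)
    exact ⟨⟨y, torsion_sup I J _ y.2 (hyz ▸ z.2)⟩, Prod.ext rfl (Subtype.ext hyz)⟩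
  · refine (ModuleCat.mono_iff_injective _).2 fun x y h => ?_
    exact Subtype.ext (congrArg (fun p => (p.1 : E.X j)) h)
  · refine (ModuleCat.epi_iff_surjective _).2 fun x => ?_
    obtain ⟨y, hy, z, hz, h⟩ := exists_sub_eq I J (E.X j) x.2
    exact ⟨(⟨y, hy⟩, ⟨z, hz⟩), Subtype.ext h⟩

variable {M : ModuleCat.{u} R} (E : InjectiveResolution M)

/-- The natural map `H^i_{L'}(M) ⟶ H^i_L(M)` for `L ≤ L'`, induced by `Γ_{L'} ⊆ Γ_L`. -/
noncomputable def cohIncl {L L' : Ideal R} (h : L ≤ L') (i : ℕ) :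
    localCoh L' E i →ₗ[R] localCoh L E i :=
  (HomologicalComplex.homologyMap
    ((NatTrans.mapHomologicalComplex (torsionIncl h) (ComplexShape.up ℕ)).app E.cocomplex) i).hom

/-- `ρ^i : H^i_{I+J}(M) ⟶ H^i_I(M) ⊕ H^i_J(M)`, `x ↦ (x, x)`. -/
noncomputable def mvRho (I J : Ideal R) (i : ℕ) :
    localCoh (I ⊔ J) E i →ₗ[R] localCoh I E i × localCoh J E i :=
  (cohIncl E le_sup_left i).prod (cohIncl E le_sup_right i)

/-- `π^i : H^i_I(M) ⊕ H^i_J(M) ⟶ H^i_{I∩J}(M)`, `(x, y) ↦ x - y`. -/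
noncomputable def mvPi (I J : Ideal R) (i : ℕ) :
    localCoh I E i × localCoh J E i →ₗ[R] localCoh (I ⊓ J) E i :=
  (cohIncl E inf_le_left i).comp (LinearMap.fst R _ _) -
    (cohIncl E inf_le_right i).comp (LinearMap.snd R _ _)

/-- `δ^i : H^i_{I∩J}(M) ⟶ H^{i+1}_{I+J}(M)`, the connecting map of the short exact sequence of
complexes `0 ⟶ Γ_{I+J}(E) ⟶ Γ_I(E) ⊕ Γ_J(E) ⟶ Γ_{I∩J}(E) ⟶ 0`. -/
noncomputable def mvDelta [IsNoetherianRing R] (I J : Ideal R) (i : ℕ) :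
    localCoh (I ⊓ J) E i →ₗ[R] localCoh (I ⊔ J) E (i + 1) :=
  ((mvShortComplex_shortExact I J E.cocomplex E.injective).δ i (i + 1) rfl).hom

end LocalCohomology

/-! ### The Weyl algebra -/

section Weyl

open MvPolynomial

variable (K : Type u) [Field K] (n : ℕ)

/-- The `n`-th Weyl algebra `A_n(K)` (for `K` of characteristic zero): the algebra of operators on
`K[X_1, …, X_n]` generated by the multiplications by the `X_i` and the partial derivatives. -/
noncomputable def weylAlgebra : Subalgebra K (Module.End K (MvPolynomial (Fin n) K)) :=
  Algebra.adjoin K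
    (Set.range (fun i : Fin n => LinearMap.mulLeft K (X i : MvPolynomial (Fin n) K)) ∪
      Set.range (fun i : Fin n => ((pderiv i : Derivation K (MvPolynomial (Fin n) K)
        (MvPolynomial (Fin n) K)) : MvPolynomial (Fin n) K →ₗ[K] MvPolynomial (Fin n) K)))

theorem lmul_mem_weylAlgebra (p : MvPolynomial (Fin n) K) :
    Algebra.lmul K (MvPolynomial (Fin n) K) p ∈ weylAlgebra K n := by
  induction p using MvPolynomial.induction_on with
  | C a =>
    have : Algebra.lmul K (MvPolynomial (Fin n) K) (C a) = algebraMap K _ a :=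
      AlgHom.commutes _ a
    rw [this]
    exact Subalgebra.algebraMap_mem _ a
  | add p q hp hq => rw [map_add]; exact add_mem hp hq
  | mul_X p i hp =>
    rw [map_mul]
    exact mul_mem hp (Algebra.subset_adjoin (Or.inl ⟨i, rfl⟩))

/-- The inclusion `K[X_1, …, X_n] → A_n(K)`. -/
noncomputable def toWeyl : MvPolynomial (Fin n) K →+* weylAlgebra K n :=
  ((Algebra.lmul K (MvPolynomial (Fin n) K)).codRestrict (weylAlgebra K n)
    (lmul_mem_weylAlgebra K n)).toRingHom

variable {K n}

theorem pderiv_mem_pow (L : Ideal (MvPolynomial (Fin n) K)) (j : Fin n) (s : ℕ)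
    {a : MvPolynomial (Fin n) K} (ha : a ∈ L ^ (s + 1)) : pderiv j a ∈ L ^ s := by
  induction s generalizing a with
  | zero => simp
  | succ s ih =>
    rw [pow_succ] at ha
    induction ha using Submodule.mul_induction_on' with
    | mem_mul_mem b hb c hc =>
      rw [Derivation.leibniz, smul_eq_mul, smul_eq_mul]
      refine add_mem (Ideal.mul_mem_right _ _ hb) ?_
      rw [mul_comm, pow_succ]
      exact Ideal.mul_mem_mul (ih hb) hc
    | add b _ c _ hb hc => rw [map_add]; exact add_mem hb hc

/-- `Γ_L(N)` of an `A_n(K)`-module `N` is an `A_n(K)`-submodule. -/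
theorem smul_mem_torsion (L : Ideal (MvPolynomial (Fin n) K)) (N : Type u) [AddCommGroup N]
    [Module (weylAlgebra K n) N] (P : weylAlgebra K n) {m : N}
    (hm : ∃ s : ℕ, ∀ a ∈ L ^ s, toWeyl K n a • m = 0) :
    ∃ s : ℕ, ∀ a ∈ L ^ s, toWeyl K n a • P • m = 0 := by
  suffices H : ∀ x ∈ weylAlgebra K n, ∀ Y : weylAlgebra K n, (Y : Module.End K _) = x →
      ∀ m : N, (∃ s : ℕ, ∀ a ∈ L ^ s, toWeyl K n a • m = 0) →
        ∃ s : ℕ, ∀ a ∈ L ^ s, toWeyl K n a • Y • m = 0 from H P P.2 P rfl m hm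
  intro x hx
  induction hx using Algebra.adjoin_induction with
  | mem x hx =>
    rintro Y rfl m ⟨s, hs⟩
    rcases hx with ⟨j, hj⟩ | ⟨j, hj⟩
    · refine ⟨s, fun a ha => ?_⟩
      have e : toWeyl K n a * Y = Y * toWeyl K n a := by
        apply Subtype.ext
        apply LinearMap.ext
        intro p
        change a * Y.1 p = Y.1 (a * p)
        rw [← hj]
        exact mul_left_comm a (X j) p
      rw [← mul_smul, e, mul_smul, hs a ha, smul_zero]
    · refine ⟨s + 1, fun a ha => ?_⟩
      have e : toWeyl K n a * Y + toWeyl K n (pderiv j a) = Y * toWeyl K n a := by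
        apply Subtype.ext
        apply LinearMap.ext
        intro p
        change a * Y.1 p + pderiv j a * p = Y.1 (a * p)
        rw [← hj]
        change a * pderiv j p + pderiv j a * p = pderiv j (a * p)
        rw [Derivation.leibniz, smul_eq_mul, smul_eq_mul]
        ring
      have e' := congrArg (fun Z => Z • m) e
      rw [add_smul, mul_smul, mul_smul, hs a (Ideal.pow_le_pow_right s.le_succ ha),
        hs _ (pderiv_mem_pow L j s ha), smul_zero, add_zero] at e'
      exact e'
  | algebraMap r =>
    rintro Y hY m ⟨s, hs⟩
    refine ⟨s, fun a ha => ?_⟩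
    have e : toWeyl K n a * Y = Y * toWeyl K n a := by
      apply Subtype.ext
      change _ * Y.1 = Y.1 * _
      rw [hY]
      exact (Algebra.commutes r _).symm
    rw [← mul_smul, e, mul_smul, hs a ha, smul_zero]
  | add x y hx hy ihx ihy =>
    intro Y hY m hm
    obtain ⟨s, hs⟩ := ihx ⟨x, hx⟩ rfl m hm
    obtain ⟨t, ht⟩ := ihy ⟨y, hy⟩ rfl m hm
    refine ⟨s + t, fun a ha => ?_⟩
    have e : Y = (⟨x, hx⟩ : weylAlgebra K n) + ⟨y, hy⟩ := Subtype.ext hY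
    rw [e, add_smul, smul_add, hs a (Ideal.pow_le_pow_right (Nat.le_add_right s t) ha),
      ht a (Ideal.pow_le_pow_right (Nat.le_add_left t s) ha), add_zero]
  | mul x y hx hy ihx ihy =>
    intro Y hY m hm
    have e : Y = (⟨x, hx⟩ : weylAlgebra K n) * ⟨y, hy⟩ := Subtype.ext hY
    rw [e, mul_smul]
    exact ihx ⟨x, hx⟩ rfl _ (ihy ⟨y, hy⟩ rfl m hm)

variable (K n) in
/-- Restriction of scalars from `A_n(K)`-modules to `K[X_1, …, X_n]`-modules. -/
noncomputable abbrev weylRes :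
    ModuleCat.{u} (weylAlgebra K n) ⥤ ModuleCat.{u} (MvPolynomial (Fin n) K) :=
  ModuleCat.restrictScalars (toWeyl K n)

instance : (weylRes K n).PreservesHomology :=
  Functor.preservesHomology_of_map_exact _ fun S h => by
    rw [ShortComplex.ShortExact.moduleCat_exact_iff_function_exact] at h ⊢
    exact h

/-- `Γ_L(N)` as an `A_n(K)`-submodule of an `A_n(K)`-module `N`. -/
def weylTorsion (L : Ideal (MvPolynomial (Fin n) K)) (N : ModuleCat.{u} (weylAlgebra K n)) :
    Submodule (weylAlgebra K n) N where
  carrier := {m | ∃ s : ℕ, ∀ a ∈ L ^ s, toWeyl K n a • m = 0}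
  zero_mem' := (torsion L ((weylRes K n).obj N)).zero_mem
  add_mem' hx hy := (torsion L ((weylRes K n).obj N)).add_mem hx hy
  smul_mem' P _ hm := smul_mem_torsion L N P hm

/-- The functor `Γ_L` on `A_n(K)`-modules. -/
noncomputable def weylTorsionFunctor (L : Ideal (MvPolynomial (Fin n) K)) :
    ModuleCat.{u} (weylAlgebra K n) ⥤ ModuleCat.{u} (weylAlgebra K n) where
  obj N := ModuleCat.of _ (weylTorsion L N)
  map f := ModuleCat.ofHom (f.hom.restrict fun _ hm =>
    map_mem_torsion L ((weylRes K n).map f).hom hm)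
  map_id _ := rfl
  map_comp _ _ := rfl

instance (L : Ideal (MvPolynomial (Fin n) K)) : (weylTorsionFunctor L).Additive where
  map_add := rfl

/-- The complex of `A_n(K)`-modules `Γ_L(Q)`, for a cochain complex `Q` of `A_n(K)`-modules. -/
noncomputable abbrev weylTorsionComplex (L : Ideal (MvPolynomial (Fin n) K))
    (Q : CochainComplex (ModuleCat.{u} (weylAlgebra K n)) ℕ) :
    CochainComplex (ModuleCat.{u} (weylAlgebra K n)) ℕ :=
  ((weylTorsionFunctor L).mapHomologicalComplex (ComplexShape.up ℕ)).obj Q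

/-- The complex of `A_n(K)`-modules `Q`, regarded as a complex of `K[X_1, …, X_n]`-modules. -/
noncomputable abbrev weylResComplex (Q : CochainComplex (ModuleCat.{u} (weylAlgebra K n)) ℕ) :
    CochainComplex (ModuleCat.{u} (MvPolynomial (Fin n) K)) ℕ :=
  ((weylRes K n).mapHomologicalComplex (ComplexShape.up ℕ)).obj Q

variable (K n) in
/-- `R = K[X_1, …, X_n]` as a module over itself. -/
noncomputable abbrev polyR : ModuleCat.{u} (MvPolynomial (Fin n) K) :=
  ModuleCat.of _ (MvPolynomial (Fin n) K)

variable (K n) in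
/-- `R = K[X_1, …, X_n]` as a module over `A_n(K)`, differential operators acting on
polynomials. -/
noncomputable abbrev polyD : ModuleCat.{u} (weylAlgebra K n) :=
  ModuleCat.of _ (MvPolynomial (Fin n) K)

/-- Given a resolution `Q` of `R` by injective `A_n(K)`-modules and a resolution `E` of `R` by
injective `R`-modules, an `R`-linear chain map `Q ⟶ E` is a comparison map if it lifts the
identity of `R`. -/
def IsComparison (Q : InjectiveResolution (polyD K n)) (E : InjectiveResolution (polyR K n))
    (c : weylResComplex Q.cocomplex ⟶ E.cocomplex) : Prop :=
  ∀ r : MvPolynomial (Fin n) K,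
    (c.f 0).hom ((Q.ι.f 0).hom r : Q.cocomplex.X 0) = (E.ι.f 0).hom r

/-- The chain map `Γ_L(Q) ⟶ Γ_L(E)` obtained from `c : Q ⟶ E` by restriction. -/
noncomputable def torsionComparison (L : Ideal (MvPolynomial (Fin n) K))
    {Q : CochainComplex (ModuleCat.{u} (weylAlgebra K n)) ℕ}
    {E : CochainComplex (ModuleCat.{u} (MvPolynomial (Fin n) K)) ℕ}
    (c : weylResComplex Q ⟶ E) :
    weylResComplex (weylTorsionComplex L Q) ⟶ torsionComplex L E where
  f j := ModuleCat.ofHom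
    (X := (weylRes K n).obj ((weylTorsionFunctor L).obj (Q.X j)))
    { toFun := fun x => ⟨(c.f j).hom x.1, map_mem_torsion L (c.f j).hom x.2⟩
      map_add' := fun x y => Subtype.ext (map_add (c.f j).hom x.1 y.1)
      map_smul' := fun r x => Subtype.ext
        (map_smul (c.f j).hom r (show (weylRes K n).obj (Q.X j) from x.1)) }
  comm' j k _ := by
    ext x
    apply Subtype.ext
    exact congrArg (fun f => f.hom x.1) (c.comm j k)

/-- The `R`-linear map `H^i(Γ_L(Q)) ⟶ H^i(Γ_L(E)) = H^i_L(R)` induced by a chain map `Q ⟶ E`;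
the source is an `A_n(K)`-module. -/
noncomputable def cohComparison (L : Ideal (MvPolynomial (Fin n) K))
    {Q : InjectiveResolution (polyD K n)} {E : InjectiveResolution (polyR K n)}
    (c : weylResComplex Q.cocomplex ⟶ E.cocomplex) (i : ℕ) :
    (weylRes K n).obj ((weylTorsionComplex L Q.cocomplex).homology i) ⟶ localCoh L E i :=
  (((weylTorsionComplex L Q.cocomplex).sc i).mapHomologyIso (weylRes K n)).inv ≫
    HomologicalComplex.homologyMap (torsionComparison L c) i

end Weyl

end MVWeyl

/-! The crux is that in characteristic zero `A_n(K)` is free as a right `R`-module on the monomials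
`∂^α`. Spanning follows by moving coefficients to the right (`exists_rightSymbol_eq`). Independence
follows from commutators with `X_i`, which differentiate formally in `∂_i`
(`rightSymbol_injective`).

Freeness makes restriction of scalars preserve injectives. By Baer's criterion it suffices to extend
an `R`-linear `f : J → M` to `R`. A relation `∑ P_a a = 0` in `A_n(K)` forces `∑ P_a f(a) = 0`, so
`f` extends to the left ideal `A_n(K) J`, and then to `A_n(K)` because `M` is injective there
(`baer_of_weyl_baer`).

Hence a resolution `Q` by injective `A_n(K)`-modules is also an injective resolution over `R`. A
comparison `Q → E` is therefore a homotopy equivalence, unique up to homotopy, and `Γ_L` is the same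
group over either ring. So `H^i(Γ_L(Q)) → H^i_L(R)` is bijective and transports the
`A_n(K)`-structure. Another resolution gives the same structure, since the identity of `R` lifts to
an `A_n(K)`-linear map between the two.

Linearity of the Mayer–Vietoris maps is checked on cocycles in `Q`. For `δ`, a cocycle `z` splits as
`a - b` by injectivity over `R`; then `Pz = Pa - Pb` is a splitting of `Pz`, and `d(Pa) = P(da)`. -/

namespace MVWeyl

/-! ### Freeness of `A_n(K)` as a right `R`-module, and restriction of injectives -/

section Flatness

open MvPolynomial

variable (K : Type u) [Field K] (n : ℕ)

/-- The partial derivative `∂_i`, as an element of the Weyl algebra. -/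
noncomputable def weylD (i : Fin n) : weylAlgebra K n :=
  ⟨(pderiv i : Derivation K (MvPolynomial (Fin n) K) (MvPolynomial (Fin n) K)),
    Algebra.subset_adjoin (Or.inr ⟨i, rfl⟩)⟩

theorem toWeyl_apply (r p : MvPolynomial (Fin n) K) : (toWeyl K n r).1 p = r * p := rfl

variable {K n} in
theorem weylAlgebra_ext {P Q : weylAlgebra K n} (h : ∀ p, P.1 p = Q.1 p) : P = Q :=
  Subtype.ext (LinearMap.ext h)

theorem weylD_mul_toWeyl (i : Fin n) (r : MvPolynomial (Fin n) K) :
    weylD K n i * toWeyl K n r = toWeyl K n r * weylD K n i + toWeyl K n (pderiv i r) := by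
  refine weylAlgebra_ext fun p => ?_
  change pderiv i (r * p) = r * pderiv i p + pderiv i r * p
  rw [Derivation.leibniz, smul_eq_mul, smul_eq_mul]
  ring

theorem weylD_comm (i j : Fin n) : weylD K n i * weylD K n j = weylD K n j * weylD K n i := by
  refine weylAlgebra_ext fun p => ?_
  change pderiv i (pderiv j p) = pderiv j (pderiv i p)
  have h : ⁅(pderiv i : Derivation K (MvPolynomial (Fin n) K) (MvPolynomial (Fin n) K)),
      (pderiv j : Derivation K (MvPolynomial (Fin n) K) (MvPolynomial (Fin n) K))⁆ = 0 := by
    refine MvPolynomial.derivation_ext fun k => ?_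
    rw [Derivation.commutator_apply]
    simp only [pderiv_X, Pi.single_apply]
    split_ifs <;> simp
  have := congrArg (fun d => d p) h
  rw [Derivation.commutator_apply] at this
  exact sub_eq_zero.1 this

-- Evaluation of polynomials needs a commutative target, so it is performed in the subalgebra
-- generated by the `x i`, which is commutative.
open scoped IsMulCommutative in
theorem exists_algHom_of_commute {k A σ : Type*} [CommRing k] [Ring A] [Algebra k A] (x : σ → A)
    (hx : ∀ i j, x i * x j = x j * x i) :
    ∃ φ : MvPolynomial σ k →ₐ[k] A, ∀ i, φ (X i) = x i := by
  have := Algebra.isMulCommutative_adjoin k (s := Set.range x) (by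
    rintro _ ⟨i, rfl⟩ _ ⟨j, rfl⟩
    exact hx i j)
  exact ⟨(Algebra.adjoin k (Set.range x)).val.comp
    (aeval fun i => ⟨x i, Algebra.subset_adjoin ⟨i, rfl⟩⟩), fun i => by simp⟩

/-- The differential operators with constant coefficients: the algebra homomorphism
`K[Y_1, …, Y_n] → A_n(K)` sending `Y_i` to `∂_i`. -/
noncomputable def constDiff : MvPolynomial (Fin n) K →ₐ[K] weylAlgebra K n :=
  (exists_algHom_of_commute (weylD K n) (weylD_comm K n)).choose

theorem constDiff_X (i : Fin n) : constDiff K n (X i) = weylD K n i :=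
  (exists_algHom_of_commute (weylD K n) (weylD_comm K n)).choose_spec i

/-- The commutator with `X_i` is a derivation taking `∂_j` to `δ_ij`, so on polynomials in the `∂_j`
it is the formal derivative. -/
theorem constDiff_mul_X (i : Fin n) (p : MvPolynomial (Fin n) K) :
    constDiff K n p * toWeyl K n (X i) =
      toWeyl K n (X i) * constDiff K n p + constDiff K n (pderiv i p) := by
  induction p using MvPolynomial.induction_on with
  | C a =>
    have : constDiff K n (C a) = algebraMap K _ a := (constDiff K n).commutes a
    rw [this, Algebra.commutes, pderiv_C, map_zero, add_zero]
  | add p q hp hq => rw [map_add, add_mul, hp, hq, map_add, map_add]; noncomm_ring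
  | mul_X p j hp =>
    have h1 : weylD K n j * toWeyl K n (X i) = toWeyl K n (X i) * weylD K n j +
        constDiff K n (pderiv i (X j)) := by
      rw [weylD_mul_toWeyl, pderiv_X, pderiv_X]
      congr 1
      rcases eq_or_ne i j with rfl | h
      · simp
      · simp [h, h.symm]
    rw [Derivation.leibniz, map_mul, constDiff_X, mul_assoc, h1, mul_add, ← mul_assoc, hp,
      smul_eq_mul, smul_eq_mul, mul_comm (X j), map_add, map_mul, map_mul, constDiff_X]
    noncomm_ring

/-- For a left `A_n(K)`-module `M`, the map `(m_α) ↦ ∑ ∂^α m_α`. -/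
noncomputable def diffSum (M : Type u) [AddCommGroup M] [Module (weylAlgebra K n) M] :
    ((Fin n →₀ ℕ) →₀ M) →+ M :=
  Finsupp.liftAddHom fun α => DistribSMul.toAddMonoidHom M (constDiff K n (monomial α 1))

variable {K n} in
theorem diffSum_single {M : Type u} [AddCommGroup M] [Module (weylAlgebra K n) M]
    (α : Fin n →₀ ℕ) (m : M) :
    diffSum K n M (Finsupp.single α m) = constDiff K n (monomial α 1) • m := by
  simp [diffSum]

/-- The operator `∑ ∂^α r_α` with right coefficients `r_α`. -/
noncomputable def rightSymbol : ((Fin n →₀ ℕ) →₀ MvPolynomial (Fin n) K) →+ weylAlgebra K n :=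
  (diffSum K n (weylAlgebra K n)).comp (Finsupp.mapRange.addMonoidHom (toWeyl K n).toAddMonoidHom)

theorem rightSymbol_single (α : Fin n →₀ ℕ) (r : MvPolynomial (Fin n) K) :
    rightSymbol K n (Finsupp.single α r) = constDiff K n (monomial α 1) * toWeyl K n r := by
  simp [rightSymbol, diffSum_single]

variable {K n} in
theorem rightSymbol_smul {M : Type u} [AddCommGroup M] [Module (weylAlgebra K n) M]
    [Module (MvPolynomial (Fin n) K) M]
    (hM : ∀ (r : MvPolynomial (Fin n) K) (m : M), r • m = toWeyl K n r • m)
    (F : (Fin n →₀ ℕ) →₀ MvPolynomial (Fin n) K) (m : M) :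
    rightSymbol K n F • m = diffSum K n M
      (Finsupp.mapRange.linearMap (LinearMap.toSpanSingleton (MvPolynomial (Fin n) K) M m) F) := by
  induction F using Finsupp.induction_linear with
  | zero => simp
  | add F G hF hG => rw [map_add, add_smul, hF, hG, map_add, map_add]
  | single α r =>
    rw [rightSymbol_single, Finsupp.mapRange.linearMap_apply, Finsupp.mapRange_single,
      diffSum_single, LinearMap.toSpanSingleton_apply, hM, mul_smul]

/-- The derivative of a right symbol with respect to `∂_i`. -/
noncomputable def symbolDeriv (i : Fin n) :
    ((Fin n →₀ ℕ) →₀ MvPolynomial (Fin n) K) →+ ((Fin n →₀ ℕ) →₀ MvPolynomial (Fin n) K) :=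
  Finsupp.liftAddHom fun α => (Finsupp.singleAddHom (α - Finsupp.single i 1)).comp
    (AddMonoidHom.mulLeft (α i : MvPolynomial (Fin n) K))

theorem symbolDeriv_single (i : Fin n) (α : Fin n →₀ ℕ) (r : MvPolynomial (Fin n) K) :
    symbolDeriv K n i (Finsupp.single α r) =
      Finsupp.single (α - Finsupp.single i 1) ((α i : MvPolynomial (Fin n) K) * r) := by
  simp [symbolDeriv]

theorem symbolDeriv_apply (i : Fin n) (F : (Fin n →₀ ℕ) →₀ MvPolynomial (Fin n) K)
    (α : Fin n →₀ ℕ) :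
    symbolDeriv K n i F α =
      ((α i + 1 : ℕ) : MvPolynomial (Fin n) K) * F (α + Finsupp.single i 1) := by
  induction F using Finsupp.induction_linear with
  | zero => simp
  | add F G hF hG => rw [map_add, Finsupp.add_apply, hF, hG, Finsupp.add_apply, mul_add]
  | single β r =>
    rw [symbolDeriv_single, Finsupp.single_apply, Finsupp.single_apply]
    by_cases h : β = α + Finsupp.single i 1
    · subst h
      simp
    · rw [if_neg h, mul_zero]
      split_ifs with h'
      · have : β i = 0 := by
          by_contra h0
          apply h
          rw [← h', tsub_add_cancel_of_le]
          rw [Finsupp.single_le_iff]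
          omega
        rw [this, Nat.cast_zero, zero_mul]
      · rfl

theorem rightSymbol_mul_X (i : Fin n) (F : (Fin n →₀ ℕ) →₀ MvPolynomial (Fin n) K) :
    rightSymbol K n F * toWeyl K n (X i) =
      toWeyl K n (X i) * rightSymbol K n F + rightSymbol K n (symbolDeriv K n i F) := by
  induction F using Finsupp.induction_linear with
  | zero => simp
  | add F G hF hG => rw [map_add, add_mul, hF, hG, map_add, map_add]; noncomm_ring
  | single α r =>
    have h : constDiff K n (pderiv i (monomial α 1)) =
        constDiff K n (monomial (α - Finsupp.single i 1) 1) * toWeyl K n (α i) := by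
      rw [pderiv_monomial, one_mul, map_natCast (toWeyl K n),
        show monomial (α - Finsupp.single i 1) ((α i : ℕ) : K) =
          (α i) • monomial (α - Finsupp.single i 1) (1 : K) by
          rw [← map_nsmul (monomial _), nsmul_one], map_nsmul, nsmul_eq_mul, Nat.cast_comm]
    rw [symbolDeriv_single, rightSymbol_single, rightSymbol_single, mul_assoc, ← map_mul,
      mul_comm r, map_mul, ← mul_assoc, constDiff_mul_X, h, map_mul]
    noncomm_ring

theorem exists_rightSymbol_eq (P : weylAlgebra K n) : ∃ F, rightSymbol K n F = P := by
  -- Strengthened for the induction: operators of the form `∑ ∂^α r_α` are stable under left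
  -- multiplication by every `Y`. Applying this to `1` gives the claim.
  suffices H : ∀ x ∈ weylAlgebra K n, ∀ Y : weylAlgebra K n, (Y : Module.End K _) = x →
      ∀ F, ∃ G, rightSymbol K n G = Y * rightSymbol K n F by
    obtain ⟨G, hG⟩ := H P P.2 P rfl (Finsupp.single 0 1)
    refine ⟨G, hG.trans ?_⟩
    rw [rightSymbol_single, map_one (toWeyl K n), mul_one, show monomial 0 (1 : K) = 1 from rfl,
      map_one, mul_one]
  intro x hx
  induction hx using Algebra.adjoin_induction with
  | mem x hx =>
    rintro Y rfl F
    rcases hx with ⟨j, hj⟩ | ⟨j, hj⟩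
    · have hY : Y = toWeyl K n (X j) := Subtype.ext hj.symm
      -- Moving `X_j` from left to right past the `∂^α` costs the commutator, which is the symbol
      -- derivative.
      refine ⟨Finsupp.mapRange.addMonoidHom (AddMonoidHom.mulRight (X j)) F -
        symbolDeriv K n j F, ?_⟩
      rw [hY, map_sub, sub_eq_iff_eq_add, ← rightSymbol_mul_X]
      induction F using Finsupp.induction_linear with
      | zero => simp
      | add F G hF hG => rw [map_add, map_add, hF, hG, map_add, add_mul]
      | single α r =>
        rw [Finsupp.mapRange.addMonoidHom_apply, Finsupp.mapRange_single, rightSymbol_single,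
          rightSymbol_single, mul_assoc, ← map_mul]
        rfl
    · have hY : Y = constDiff K n (X j) := by
        rw [constDiff_X]
        exact Subtype.ext hj.symm
      induction F using Finsupp.induction_linear with
      | zero => exact ⟨0, by simp⟩
      | add F G hF hG =>
        obtain ⟨F', hF⟩ := hF
        obtain ⟨G', hG⟩ := hG
        exact ⟨F' + G', by rw [map_add, map_add, hF, hG, mul_add]⟩
      | single α r =>
        refine ⟨Finsupp.single (Finsupp.single j 1 + α) r, ?_⟩
        rw [rightSymbol_single, rightSymbol_single, hY, ← mul_assoc, ← map_mul, X,
          monomial_mul, one_mul]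
  | algebraMap c =>
    intro Y hY F
    have hY : Y = algebraMap K _ c := Subtype.ext hY
    refine ⟨Finsupp.mapRange.addMonoidHom (AddMonoidHom.mulRight (C c)) F, ?_⟩
    rw [hY, Algebra.commutes]
    induction F using Finsupp.induction_linear with
    | zero => simp
    | add F G hF hG => rw [map_add, map_add, hF, hG, map_add, add_mul]
    | single α r =>
      have hc : algebraMap K (weylAlgebra K n) c = toWeyl K n (C c) :=
        weylAlgebra_ext fun p => Algebra.smul_def c p
      rw [Finsupp.mapRange.addMonoidHom_apply, Finsupp.mapRange_single, rightSymbol_single,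
        rightSymbol_single, mul_assoc, hc, ← map_mul]
      rfl
  | add x y hx hy ihx ihy =>
    intro Y hY F
    obtain ⟨G, hG⟩ := ihx ⟨x, hx⟩ rfl F
    obtain ⟨G', hG'⟩ := ihy ⟨y, hy⟩ rfl F
    refine ⟨G + G', ?_⟩
    have e : Y = (⟨x, hx⟩ : weylAlgebra K n) + ⟨y, hy⟩ := Subtype.ext hY
    rw [map_add, hG, hG', e, add_mul]
  | mul x y hx hy ihx ihy =>
    intro Y hY F
    obtain ⟨G, hG⟩ := ihy ⟨y, hy⟩ rfl F
    obtain ⟨G', hG'⟩ := ihx ⟨x, hx⟩ rfl G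
    refine ⟨G', ?_⟩
    have e : Y = (⟨x, hx⟩ : weylAlgebra K n) * ⟨y, hy⟩ := Subtype.ext hY
    rw [hG', hG, e, mul_assoc]

theorem toWeyl_injective : Function.Injective (toWeyl K n) := by
  intro r s h
  have := congrArg (fun P => P.1 (1 : MvPolynomial (Fin n) K)) h
  simpa [toWeyl_apply] using this

/-- In characteristic zero, the coefficients of `∑ ∂^α r_α` are determined by the operator. -/
theorem rightSymbol_injective [CharZero K] : Function.Injective (rightSymbol K n) := by
  rw [injective_iff_map_eq_zero]
  -- Induction on a strict bound `N` for the total degree in the `∂_i`; differentiating a symbol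
  -- lowers the bound by one.
  suffices H : ∀ (N : ℕ) (F : (Fin n →₀ ℕ) →₀ MvPolynomial (Fin n) K),
      (∀ α, N ≤ α.degree → F α = 0) → rightSymbol K n F = 0 → F = 0 by
    intro F hF
    refine H (F.support.sup Finsupp.degree + 1) F (fun α hα => ?_) hF
    by_contra h
    have := Finset.le_sup (f := Finsupp.degree) (Finsupp.mem_support_iff.2 h)
    omega
  intro N
  induction N with
  | zero => intro F h _; ext1 α; exact h α (Nat.zero_le _)
  | succ N ih =>
    intro F hF h0
    have hd : ∀ i, symbolDeriv K n i F = 0 := by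
      intro i
      refine ih _ (fun α hα => ?_) ?_
      · rw [symbolDeriv_apply, hF, mul_zero]
        rw [map_add, Finsupp.degree_single]
        omega
      · have := rightSymbol_mul_X K n i F
        rw [h0, zero_mul, mul_zero, zero_add] at this
        exact this.symm
    have hα : ∀ α, α ≠ 0 → F α = 0 := by
      intro α hα
      obtain ⟨i, hi⟩ := Finsupp.ne_iff.1 hα
      have := DFunLike.congr_fun (hd i) (α - Finsupp.single i 1)
      rw [symbolDeriv_apply, tsub_add_cancel_of_le
        (Finsupp.single_le_iff.2 (Nat.one_le_iff_ne_zero.2 hi))] at this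
      -- Characteristic zero enters here: the integer factor produced by differentiation is nonzero
      -- in `R`.
      exact (mul_eq_zero.1 this).resolve_left (Nat.cast_ne_zero.2 (Nat.succ_ne_zero _))
    have hF0 : F = Finsupp.single 0 (F 0) := by
      ext1 α
      rw [Finsupp.single_apply]
      split_ifs with h
      · rw [h]
      · exact hα α (Ne.symm h)
    rw [hF0, rightSymbol_single, show monomial 0 (1 : K) = 1 from rfl, map_one, one_mul] at h0
    rw [hF0, (map_eq_zero_iff _ (toWeyl_injective K n)).1 h0, Finsupp.single_zero]

variable {K n}

theorem rightSymbol_mapRange_subtype (J : Ideal (MvPolynomial (Fin n) K)) (a : J)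
    (F : (Fin n →₀ ℕ) →₀ MvPolynomial (Fin n) K) :
    rightSymbol K n (Finsupp.mapRange.linearMap J.subtype (Finsupp.mapRange.linearMap
      (LinearMap.toSpanSingleton (MvPolynomial (Fin n) K) J a) F)) =
      rightSymbol K n F * toWeyl K n a.1 := by
  induction F using Finsupp.induction_linear with
  | zero => rw [map_zero, map_zero, map_zero, zero_mul]
  | add F G hF hG => rw [map_add, map_add, map_add, hF, hG, map_add, add_mul]
  | single α r =>
    rw [rightSymbol_single, mul_assoc, ← map_mul, ← rightSymbol_single]
    congr 1
    rw [Finsupp.mapRange.linearMap_apply, Finsupp.mapRange.linearMap_apply,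
      Finsupp.mapRange_single (hf := map_zero _), Finsupp.mapRange_single (hf := map_zero _)]
    rfl

/-- A linear relation `∑ P_a a = 0` between elements of an ideal of `K[X_1, …, X_n]` with left
coefficients in `A_n(K)` persists under linear maps, because `A_n(K)` is free as a right
`K[X_1, …, X_n]`-module. -/
theorem linearCombination_eq_zero [CharZero K] {M : Type u} [AddCommGroup M]
    [Module (weylAlgebra K n) M] [Module (MvPolynomial (Fin n) K) M]
    (hM : ∀ (r : MvPolynomial (Fin n) K) (m : M), r • m = toWeyl K n r • m)
    (J : Ideal (MvPolynomial (Fin n) K)) (f : J →ₗ[MvPolynomial (Fin n) K] M)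
    (g : J →₀ weylAlgebra K n)
    (hg : Finsupp.linearCombination (weylAlgebra K n) (fun a : J => toWeyl K n a.1) g = 0) :
    Finsupp.linearCombination (weylAlgebra K n) (fun a : J => f a) g = 0 := by
  choose F hF using exists_rightSymbol_eq K n
  -- With `g a = ∑ ∂^α r_{a,α}`, the coefficient of `G` at `α` is `∑_a r_{a,α} a`. These are the
  -- right coefficients of the relation `hg`, so all vanish by independence, and so do their images
  -- under `f`.
  let G : (Fin n →₀ ℕ) →₀ J := ∑ a ∈ g.support,
    Finsupp.mapRange.linearMap (LinearMap.toSpanSingleton (MvPolynomial (Fin n) K) J a) (F (g a))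
  have h1 : rightSymbol K n (Finsupp.mapRange.linearMap J.subtype G) =
      Finsupp.linearCombination (weylAlgebra K n) (fun a : J => toWeyl K n a.1) g := by
    rw [Finsupp.linearCombination_apply, Finsupp.sum, map_sum, map_sum]
    refine Finset.sum_congr rfl fun a _ => ?_
    rw [rightSymbol_mapRange_subtype, hF, smul_eq_mul]
  have hG : G = 0 := by
    rw [hg, map_eq_zero_iff _ (rightSymbol_injective K n)] at h1
    ext1 α
    exact Subtype.ext (DFunLike.congr_fun h1 α)
  have h2 : diffSum K n M (Finsupp.mapRange.linearMap f G) =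
      Finsupp.linearCombination (weylAlgebra K n) (fun a : J => f a) g := by
    rw [Finsupp.linearCombination_apply, Finsupp.sum, map_sum, map_sum]
    refine Finset.sum_congr rfl fun a _ => ?_
    conv_rhs => rw [← hF (g a), rightSymbol_smul hM]
    congr 1
    ext1 α
    exact map_smul f (F (g a) α) a
  rw [← h2, hG, map_zero, map_zero]

/-- The condition `hv` says exactly that `x a ↦ v a` is well defined on the left ideal spanned by
the `x a`; Baer's criterion then extends it to `A`. -/
theorem exists_linearMap_of_baer {A M ι : Type*} [Ring A] [AddCommGroup M] [Module A M]
    (h : Module.Baer A M) (x : ι → A) (v : ι → M)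
    (hv : ∀ g : ι →₀ A, Finsupp.linearCombination A x g = 0 →
      Finsupp.linearCombination A v g = 0) :
    ∃ g : A →ₗ[A] M, ∀ a, g (x a) = v a := by
  let Φ := Finsupp.linearCombination A x
  let Ψ := Finsupp.linearCombination A v
  have hker : Φ.ker ≤ Ψ.ker := fun g hg => hv g hg
  obtain ⟨g, hg⟩ := h Φ.range ((Φ.ker.liftQ Ψ hker).comp Φ.quotKerEquivRange.symm.toLinearMap)
  refine ⟨g, fun a => ?_⟩
  have h1 : Φ (Finsupp.single a 1) = x a := by
    rw [Finsupp.linearCombination_single, one_smul]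
  have h2 : Ψ (Finsupp.single a 1) = v a := by
    rw [Finsupp.linearCombination_single, one_smul]
  rw [hg (x a) ⟨_, h1⟩, LinearMap.comp_apply, ← h2]
  have h3 : Φ.quotKerEquivRange (Φ.ker.mkQ (Finsupp.single a 1)) =
      (⟨x a, ⟨_, h1⟩⟩ : Φ.range) := Subtype.ext h1
  rw [← h3, LinearEquiv.coe_coe, LinearEquiv.symm_apply_apply, Submodule.mkQ_apply,
    Submodule.liftQ_apply]

/-- If an `A_n(K)`-module satisfies Baer's criterion, then so does the underlying
`K[X_1, …, X_n]`-module. -/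
theorem baer_of_weyl_baer [CharZero K] {M : Type u} [AddCommGroup M] [Module (weylAlgebra K n) M]
    [Module (MvPolynomial (Fin n) K) M]
    (hM : ∀ (r : MvPolynomial (Fin n) K) (m : M), r • m = toWeyl K n r • m)
    (h : Module.Baer (weylAlgebra K n) M) : Module.Baer (MvPolynomial (Fin n) K) M := by
  intro J f
  obtain ⟨g, hg⟩ := exists_linearMap_of_baer h (fun a : J => toWeyl K n a.1) (fun a => f a)
    (linearCombination_eq_zero hM J f)
  -- The extension to `R` is the restriction of `g` along `R → A_n(K)`, namely `r ↦ r • g 1`.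
  refine ⟨LinearMap.toSpanSingleton _ M (g 1), fun r hr => ?_⟩
  rw [LinearMap.toSpanSingleton_apply, hM, ← map_smul, smul_eq_mul, mul_one]
  exact hg ⟨r, hr⟩

instance weylRes_injective [CharZero K] (N : ModuleCat.{u} (weylAlgebra K n)) [Injective N] :
    Injective ((weylRes K n).obj N) := by
  have h : Module.Injective (weylAlgebra K n) N :=
    (Module.injective_iff_injective_object _ _).2 (inferInstanceAs (Injective N))
  have h' : Module.Baer (MvPolynomial (Fin n) K) ((weylRes K n).obj N) :=
    baer_of_weyl_baer (M := ((weylRes K n).obj N)) (fun _ _ => rfl) (Module.Baer.of_injective h)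
  exact (Module.injective_iff_injective_object _ ((weylRes K n).obj N)).1 h'.injective

end Flatness


/-! ### Cohomology classes and representing cocycles -/

section Representatives

variable {S : Type u} [Ring S] {C D : CochainComplex (ModuleCat.{u} S) ℕ} {i : ℕ}

/-- The cocycle `z` represents the cohomology class `x`. -/
def Represents (C : CochainComplex (ModuleCat.{u} S) ℕ) (i : ℕ) (z : C.X i) (x : C.homology i) :
    Prop :=
  ∃ w : C.cycles i, (C.iCycles i).hom w = z ∧ (C.homologyπ i).hom w = x

theorem exists_represents (x : C.homology i) : ∃ z, Represents C i z x := by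
  obtain ⟨w, hw⟩ := (ModuleCat.epi_iff_surjective (C.homologyπ i)).1 inferInstance x
  exact ⟨_, w, rfl, hw⟩

theorem Represents.unique {z : C.X i} {x y : C.homology i} (hx : Represents C i z x)
    (hy : Represents C i z y) : x = y := by
  obtain ⟨w, hw, rfl⟩ := hx
  obtain ⟨v, hv, rfl⟩ := hy
  rw [(ModuleCat.mono_iff_injective (C.iCycles i)).1 inferInstance (hw.trans hv.symm)]

theorem Represents.d_eq_zero {z : C.X i} {x : C.homology i} (hx : Represents C i z x) (j : ℕ) :
    (C.d i j).hom z = 0 := by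
  obtain ⟨w, rfl, -⟩ := hx
  exact congrArg (fun f => f.hom w) (C.iCycles_d i j)

theorem Represents.map {z : C.X i} {x : C.homology i} (hx : Represents C i z x) (f : C ⟶ D) :
    Represents D i ((f.f i).hom z) ((HomologicalComplex.homologyMap f i).hom x) := by
  obtain ⟨w, rfl, rfl⟩ := hx
  refine ⟨(HomologicalComplex.cyclesMap f i).hom w, ?_, ?_⟩
  · exact congrArg (fun f => f.hom w) (HomologicalComplex.cyclesMap_i f i)
  · exact (congrArg (fun f => f.hom w) (HomologicalComplex.homologyπ_naturality f i)).symm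

theorem Represents.smul {z : C.X i} {x : C.homology i} (hx : Represents C i z x) (r : S) :
    Represents C i (r • z) (r • x) := by
  obtain ⟨w, rfl, rfl⟩ := hx
  exact ⟨r • w, map_smul _ _ _, map_smul _ _ _⟩

theorem exists_represents_of_d_eq_zero {z : C.X i} (hz : (C.d i (i + 1)).hom z = 0) :
    ∃ x, Represents C i z x :=
  ⟨_, C.cyclesMk z (i + 1) (by simp) hz, C.i_cyclesMk z (i + 1) (by simp) hz, rfl⟩

/-- The snake recipe on elements: lift the cocycle to `y`, differentiate, and pull back to `t`. Any
choice of lift `y` is allowed. -/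
theorem represents_δ {T : ShortComplex (CochainComplex (ModuleCat.{u} S) ℕ)} (hT : T.ShortExact)
    {x : T.X₃.homology i} {z : T.X₃.X i} (hx : Represents T.X₃ i z x) (y : T.X₂.X i)
    (hy : (T.g.f i).hom y = z) (t : T.X₁.X (i + 1))
    (ht : (T.f.f (i + 1)).hom t = (T.X₂.d i (i + 1)).hom y) :
    Represents T.X₁ (i + 1) t ((hT.δ i (i + 1) rfl).hom x) := by
  have hz := hx.d_eq_zero (i + 1)
  have h := hT.δ_apply i (i + 1) rfl z hz y hy t ht (i + 2) (by simp)
  refine ⟨_, T.X₁.i_cyclesMk t (i + 2) (by simp) (hT.d_eq_zero_of_f_eq_d_apply i (i + 1) y t ht _),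
    h.symm.trans ?_⟩
  refine congrArg (hT.δ i (i + 1) rfl).hom (Represents.unique (C := T.X₃) (z := z) ⟨_, ?_, rfl⟩ hx)
  exact T.X₃.i_cyclesMk z (i + 1) (by simp) hz

end Representatives

/-! ### Comparing resolutions over `A_n(K)` and over `R` -/

section Comparison

variable {K : Type u} [Field K] {n : ℕ}

variable (K n) in
/-- `R` as a module over itself is the restriction of `R` as an `A_n(K)`-module. -/
noncomputable def polyIso : polyR K n ≅ (weylRes K n).obj (polyD K n) where
  hom := ModuleCat.ofHom (Y := (weylRes K n).obj (polyD K n))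
    { toFun := fun r => r
      map_add' := fun _ _ => rfl
      map_smul' := fun _ _ => rfl }
  inv := ModuleCat.ofHom (X := (weylRes K n).obj (polyD K n))
    { toFun := fun r => r
      map_add' := fun _ _ => rfl
      map_smul' := fun _ _ => rfl }
  hom_inv_id := rfl
  inv_hom_id := rfl

/-- A resolution of `R` by injective `A_n(K)`-modules is a resolution by injective `R`-modules. -/
noncomputable def resResolution [CharZero K] (Q : InjectiveResolution (polyD K n)) :
    InjectiveResolution (polyR K n) where
  cocomplex := weylResComplex Q.cocomplex
  injective j := weylRes_injective (Q.cocomplex.X j)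
  ι := (CochainComplex.single₀ _).map (polyIso K n).hom ≫
    (HomologicalComplex.singleMapHomologicalComplex (weylRes K n) (ComplexShape.up ℕ) 0).inv.app
      (polyD K n) ≫ ((weylRes K n).mapHomologicalComplex (ComplexShape.up ℕ)).map Q.ι
  quasiIso := inferInstance

theorem resResolution_ι [CharZero K] (Q : InjectiveResolution (polyD K n))
    (r : MvPolynomial (Fin n) K) :
    ((resResolution Q).ι.f 0).hom r = (Q.ι.f 0).hom r := by
  have h1 := HomologicalComplex.singleMapHomologicalComplex_inv_app_self (weylRes K n)
    (ComplexShape.up ℕ) 0 (polyD K n)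
  have h2 : (resResolution Q).ι.f 0 = ((CochainComplex.single₀ _).map (polyIso K n).hom).f 0 ≫
    ((HomologicalComplex.singleMapHomologicalComplex (weylRes K n) (ComplexShape.up ℕ) 0).inv.app
      (polyD K n)).f 0 ≫ (weylRes K n).map (Q.ι.f 0) := rfl
  rw [h2, h1, CochainComplex.single₀_map_f_zero]
  rfl

theorem isComparison_iff [CharZero K] (Q : InjectiveResolution (polyD K n))
    (E : InjectiveResolution (polyR K n)) (c : weylResComplex Q.cocomplex ⟶ E.cocomplex) :
    IsComparison Q E c ↔ (resResolution Q).ι ≫ c = E.ι := by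
  constructor
  · intro h
    refine HomologicalComplex.from_single_hom_ext ?_
    refine ModuleCat.hom_ext (LinearMap.ext fun r => ?_)
    exact (congrArg (c.f 0).hom (resResolution_ι Q r)).trans (h r)
  · intro h r
    exact (congrArg (c.f 0).hom (resResolution_ι Q r)).symm.trans
      (congrArg (fun f => (f.f 0).hom r) h)

/-- Separates the identification of the two versions of `Γ_L`, an isomorphism independent of `c`,
from the functor `Γ_L` over `R`, which preserves homotopies. -/
theorem torsionComparison_eq (L : Ideal (MvPolynomial (Fin n) K))
    {Q : CochainComplex (ModuleCat.{u} (weylAlgebra K n)) ℕ}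
    {E : CochainComplex (ModuleCat.{u} (MvPolynomial (Fin n) K)) ℕ} (c : weylResComplex Q ⟶ E) :
    torsionComparison L c = torsionComparison L (𝟙 (weylResComplex Q)) ≫
      ((torsionFunctor L).mapHomologicalComplex (ComplexShape.up ℕ)).map c := rfl

instance torsionComparison_id_isIso (L : Ideal (MvPolynomial (Fin n) K))
    (Q : CochainComplex (ModuleCat.{u} (weylAlgebra K n)) ℕ) :
    IsIso (torsionComparison L (𝟙 (weylResComplex Q))) := by
  have (j : ℕ) : IsIso ((torsionComparison L (𝟙 (weylResComplex Q))).f j) := by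
    rw [ConcreteCategory.isIso_iff_bijective]
    exact ⟨fun x y h => Subtype.ext (congrArg Subtype.val h), fun x => ⟨⟨x.1, x.2⟩, rfl⟩⟩
  exact HomologicalComplex.Hom.isIso_of_components _

variable {Q Q' : InjectiveResolution (polyD K n)} {E : InjectiveResolution (polyR K n)}

/-- Two lifts of the identity into an injective resolution are homotopic, and the additive functor
`Γ_L` preserves the homotopy. -/
theorem cohComparison_eq_of_isComparison [CharZero K]
    {c c' : weylResComplex Q.cocomplex ⟶ E.cocomplex} (hc : IsComparison Q E c)
    (hc' : IsComparison Q E c') (L : Ideal (MvPolynomial (Fin n) K)) (i : ℕ) :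
    cohComparison L c i = cohComparison L c' i := by
  have h : Homotopy c c' := InjectiveResolution.descHomotopy (I := resResolution Q) (J := E)
    (𝟙 (polyR K n)) c c' (((isComparison_iff Q E c).1 hc).trans (by simp))
    (((isComparison_iff Q E c').1 hc').trans (by simp))
  unfold cohComparison
  rw [torsionComparison_eq L c, torsionComparison_eq L c', HomologicalComplex.homologyMap_comp,
    HomologicalComplex.homologyMap_comp, ((torsionFunctor L).mapHomotopy h).homologyMap_eq]

theorem exists_isComparison [CharZero K] (Q : InjectiveResolution (polyD K n))
    (E : InjectiveResolution (polyR K n)) : ∃ c, IsComparison Q E c :=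
  ⟨(InjectiveResolution.homotopyEquiv (resResolution Q) E).hom,
    (isComparison_iff Q E _).2 (InjectiveResolution.homotopyEquiv_hom_ι _ _)⟩

theorem cohComparison_bijective [CharZero K]
    {c : weylResComplex Q.cocomplex ⟶ E.cocomplex} (hc : IsComparison Q E c)
    (L : Ideal (MvPolynomial (Fin n) K)) (i : ℕ) : Function.Bijective (cohComparison L c i) := by
  let e := InjectiveResolution.homotopyEquiv (resResolution Q) E
  have he : IsComparison Q E e.hom :=
    (isComparison_iff Q E _).2 (InjectiveResolution.homotopyEquiv_hom_ι _ _)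
  -- Since the induced map does not depend on the comparison, it may be computed with a homotopy
  -- equivalence.
  rw [cohComparison_eq_of_isComparison hc he]
  have h1 : IsIso (HomologicalComplex.homologyMap
      (((torsionFunctor L).mapHomologicalComplex (ComplexShape.up ℕ)).map e.hom) i) :=
    (((torsionFunctor L).mapHomotopyEquiv e).toHomologyIso i).isIso_hom
  have h2 : IsIso (HomologicalComplex.homologyMap (torsionComparison L e.hom) i) := by
    rw [torsionComparison_eq L e.hom, HomologicalComplex.homologyMap_comp]
    exact IsIso.comp_isIso' inferInstance h1
  have h3 : IsIso (cohComparison L e.hom i) := IsIso.comp_isIso' (Iso.isIso_inv _) h2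
  exact (ConcreteCategory.isIso_iff_bijective _).1 h3

theorem mapCyclesIso_inv_iCycles {C D : Type*} [Category* C] [Category* D] [Abelian C]
    [Abelian D] (F : C ⥤ D) [F.Additive] [F.PreservesHomology] (S : ShortComplex C) :
    (S.mapCyclesIso F).inv ≫ (S.map F).iCycles = F.map S.iCycles :=
  (Iso.inv_comp_eq _).2 (S.mapCyclesIso_hom_iCycles F).symm

/-- Both isomorphisms are built from the image under `F` of one left homology data of `S`, where the
square commutes. -/
theorem mapCyclesIso_inv_homologyπ {C D : Type*} [Category* C] [Category* D] [Abelian C]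
    [Abelian D] (F : C ⥤ D) [F.Additive] [F.PreservesHomology] (S : ShortComplex C) :
    (S.mapCyclesIso F).inv ≫ (S.map F).homologyπ =
      F.map S.homologyπ ≫ (S.mapHomologyIso F).inv := by
  let H := S.leftHomologyData
  let A : (S.map F).homology ≅ F.obj H.H := (H.map F).homologyIso
  let B : (S.map F).cycles ≅ F.obj H.K := (H.map F).cyclesIso
  have h1 : (S.map F).homologyπ ≫ A.hom = B.hom ≫ F.map H.π :=
    (H.map F).homologyπ_comp_homologyIso_hom
  have h2 : F.map H.π ≫ F.map H.homologyIso.inv = F.map H.cyclesIso.inv ≫ F.map S.homologyπ := by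
    rw [← F.map_comp, ← F.map_comp, H.π_comp_homologyIso_inv]
  have e1 : (S.mapHomologyIso F).hom = A.hom ≫ F.map H.homologyIso.inv :=
    congrArg Iso.hom (H.mapHomologyIso_eq F)
  have e2 : (S.mapCyclesIso F).hom = B.hom ≫ F.map H.cyclesIso.inv :=
    congrArg Iso.hom (H.mapCyclesIso_eq F)
  rw [Iso.inv_comp_eq, ← Category.assoc, Iso.eq_comp_inv, e1, e2, ← Category.assoc, h1,
    Category.assoc, h2, Category.assoc]

theorem Represents.weylRes {C : CochainComplex (ModuleCat.{u} (weylAlgebra K n)) ℕ} {i : ℕ}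
    {z : C.X i} {x : C.homology i} (hx : Represents C i z x) :
    Represents (weylResComplex C) i z (((C.sc i).mapHomologyIso (weylRes K n)).inv.hom x) := by
  obtain ⟨w, rfl, rfl⟩ := hx
  refine ⟨((C.sc i).mapCyclesIso (MVWeyl.weylRes K n)).inv.hom w, ?_, ?_⟩
  · exact congrArg (fun f => f.hom w) (mapCyclesIso_inv_iCycles (MVWeyl.weylRes K n) (C.sc i))
  · exact congrArg (fun f => f.hom w) (mapCyclesIso_inv_homologyπ (MVWeyl.weylRes K n) (C.sc i))

/-- The map `H^i(Γ_L(Q)) → H^i_L(R)` induced by `c : Q ⟶ E`, on the underlying group of the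
`A_n(K)`-module `H^i(Γ_L(Q))`. -/
noncomputable def cohComparisonHom (L : Ideal (MvPolynomial (Fin n) K))
    (c : weylResComplex Q.cocomplex ⟶ E.cocomplex) (i : ℕ) :
    (weylTorsionComplex L Q.cocomplex).homology i →+ localCoh L E i where
  toFun y := (cohComparison L c i).hom y
  map_zero' := map_zero (cohComparison L c i).hom
  map_add' := map_add (cohComparison L c i).hom

theorem cohComparisonHom_toWeyl_smul (L : Ideal (MvPolynomial (Fin n) K))
    (c : weylResComplex Q.cocomplex ⟶ E.cocomplex) (i : ℕ) (r : MvPolynomial (Fin n) K)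
    (y : (weylTorsionComplex L Q.cocomplex).homology i) :
    cohComparisonHom L c i (toWeyl K n r • y) = r • cohComparisonHom L c i y :=
  map_smul (cohComparison L c i).hom r
    (show (weylRes K n).obj ((weylTorsionComplex L Q.cocomplex).homology i) from y)

/-- The restriction of a chain map `c : Q ⟶ E` to the torsion parts. -/
noncomputable def torsionHom (L : Ideal (MvPolynomial (Fin n) K))
    (c : weylResComplex Q.cocomplex ⟶ E.cocomplex) (i : ℕ) (z : weylTorsion L (Q.cocomplex.X i)) :
    torsion L (E.cocomplex.X i) :=
  ((torsionComparison L c).f i).hom z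

theorem Represents.cohComparisonHom (L : Ideal (MvPolynomial (Fin n) K))
    (c : weylResComplex Q.cocomplex ⟶ E.cocomplex) {i : ℕ}
    {z : (weylTorsionComplex L Q.cocomplex).X i}
    {x : (weylTorsionComplex L Q.cocomplex).homology i}
    (hx : Represents (weylTorsionComplex L Q.cocomplex) i z x) :
    Represents (torsionComplex L E.cocomplex) i (torsionHom L c i z)
      (cohComparisonHom L c i x) :=
  hx.weylRes.map (torsionComparison L c)

theorem cohComparisonHom_weylMap (L : Ideal (MvPolynomial (Fin n) K))
    (f : Q.cocomplex ⟶ Q'.cocomplex) (c : weylResComplex Q'.cocomplex ⟶ E.cocomplex) (i : ℕ)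
    (y : (weylTorsionComplex L Q.cocomplex).homology i) :
    cohComparisonHom (Q := Q) L
      (((weylRes K n).mapHomologicalComplex (ComplexShape.up ℕ)).map f ≫ c) i y =
      cohComparisonHom L c i ((HomologicalComplex.homologyMap
        (((weylTorsionFunctor L).mapHomologicalComplex (ComplexShape.up ℕ)).map f) i).hom y) := by
  obtain ⟨z, hz⟩ := exists_represents y
  have h := (hz.map (((weylTorsionFunctor L).mapHomologicalComplex
    (ComplexShape.up ℕ)).map f)).cohComparisonHom L c
  exact (hz.cohComparisonHom L _).unique h

theorem IsComparison.weylMap {c : weylResComplex Q'.cocomplex ⟶ E.cocomplex}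
    (hc : IsComparison Q' E c) {f : Q.cocomplex ⟶ Q'.cocomplex} (hf : Q.ι ≫ f = Q'.ι) :
    IsComparison Q E (((weylRes K n).mapHomologicalComplex (ComplexShape.up ℕ)).map f ≫ c) := by
  intro r
  have h : (f.f 0).hom ((Q.ι.f 0).hom r) = (Q'.ι.f 0).hom r :=
    congrArg (fun f => (f.f 0).hom r) hf
  exact (congrArg (c.f 0).hom h).trans (hc r)

theorem homologyMap_smul {S : Type u} [Ring S] {C D : CochainComplex (ModuleCat.{u} S) ℕ}
    (f : C ⟶ D) (i : ℕ) (r : S) (x : C.homology i) :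
    (HomologicalComplex.homologyMap f i).hom (r • x) =
      r • (HomologicalComplex.homologyMap f i).hom x :=
  map_smul _ r x

/-! ### Lifting maps on local cohomology to `A_n(K)`-linear ones -/

/-- Two comparison maps differ by an `A_n(K)`-linear map on cohomology. -/
theorem exists_weyl_equivariant_comparison [CharZero K]
    {c : weylResComplex Q.cocomplex ⟶ E.cocomplex} (hc : IsComparison Q E c)
    {c' : weylResComplex Q'.cocomplex ⟶ E.cocomplex} (hc' : IsComparison Q' E c')
    (L : Ideal (MvPolynomial (Fin n) K)) (i : ℕ)
    (y : (weylTorsionComplex L Q.cocomplex).homology i) :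
    ∃ y' : (weylTorsionComplex L Q'.cocomplex).homology i, ∀ P : weylAlgebra K n,
      cohComparisonHom L c i (P • y) = cohComparisonHom L c' i (P • y') := by
  -- An `A_n(K)`-linear lift of the identity of `R`. Then `c'` after `f` is a second comparison from
  -- `Q`, so it induces the same map as `c`.
  let f := InjectiveResolution.desc (𝟙 (polyD K n)) Q' Q
  have hf : Q.ι ≫ f = Q'.ι := by simp [f]
  refine ⟨(HomologicalComplex.homologyMap
        (((weylTorsionFunctor L).mapHomologicalComplex (ComplexShape.up ℕ)).map f) i).hom y,
    fun P => ?_⟩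
  rw [← homologyMap_smul, ← cohComparisonHom_weylMap]
  let x : (weylRes K n).obj ((weylTorsionComplex L Q.cocomplex).homology i) := P • y
  exact congrArg (fun g => g.hom x) (cohComparison_eq_of_isComparison hc (hc'.weylMap hf) L i)

/-- The maps `H^i_{L'}(R) → H^i_L(R)` come from `A_n(K)`-linear maps. -/
theorem exists_cohIncl_cohComparisonHom (c : weylResComplex Q.cocomplex ⟶ E.cocomplex)
    {L L' : Ideal (MvPolynomial (Fin n) K)} (h : L ≤ L') (i : ℕ)
    (y : (weylTorsionComplex L' Q.cocomplex).homology i) :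
    ∃ y' : (weylTorsionComplex L Q.cocomplex).homology i, ∀ P : weylAlgebra K n,
      cohIncl E h i (cohComparisonHom L' c i (P • y)) = cohComparisonHom L c i (P • y') := by
  obtain ⟨z, hz⟩ := exists_represents y
  let z' : (weylTorsionComplex L Q.cocomplex).X i :=
    ⟨z.1, torsion_anti h ((weylRes K n).obj (Q.cocomplex.X i)) z.2⟩
  have hz0 : (Q.cocomplex.d i (i + 1)).hom z.1 = 0 :=
    congrArg Subtype.val (hz.d_eq_zero (i + 1))
  obtain ⟨y', hy'⟩ := exists_represents_of_d_eq_zero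
    (C := weylTorsionComplex L Q.cocomplex) (z := z') (Subtype.ext hz0)
  refine ⟨y', fun P => ?_⟩
  have h1 := ((hz.smul P).cohComparisonHom L' c).map
    ((NatTrans.mapHomologicalComplex (torsionIncl h) (ComplexShape.up ℕ)).app E.cocomplex)
  exact h1.unique ((hy'.smul P).cohComparisonHom L c)

/-- As `c` is only `R`-linear, `P` must be moved past the differential of `Q` before `c` is commuted
with `d`. -/
theorem comm_smul (c : weylResComplex Q.cocomplex ⟶ E.cocomplex) (i : ℕ) (P : weylAlgebra K n)
    (m : Q.cocomplex.X i) :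
    (c.f (i + 1)).hom (P • (Q.cocomplex.d i (i + 1)).hom m : Q.cocomplex.X (i + 1)) =
      (E.cocomplex.d i (i + 1)).hom ((c.f i).hom (P • m : Q.cocomplex.X i)) :=
  (congrArg (c.f (i + 1)).hom (map_smul (Q.cocomplex.d i (i + 1)).hom P m).symm).trans
    (congrArg (fun f => f.hom (P • m : Q.cocomplex.X i)) (c.comm i (i + 1))).symm

theorem hom_smul_sub (c : weylResComplex Q.cocomplex ⟶ E.cocomplex) (i : ℕ) (P : weylAlgebra K n)
    (a b : Q.cocomplex.X i) :
    (c.f i).hom (P • a : Q.cocomplex.X i) - (c.f i).hom (P • b : Q.cocomplex.X i) =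
      (c.f i).hom (P • (a - b) : Q.cocomplex.X i) :=
  (map_sub (c.f i).hom _ _).symm.trans (congrArg (c.f i).hom (smul_sub P a b).symm)

theorem represents_mvDelta {I J : Ideal (MvPolynomial (Fin n) K)} {i : ℕ}
    {x : localCoh (I ⊓ J) E i} {z : torsion (I ⊓ J) (E.cocomplex.X i)}
    (hx : Represents (torsionComplex (I ⊓ J) E.cocomplex) i z x)
    (a : torsion I (E.cocomplex.X i)) (b : torsion J (E.cocomplex.X i)) (hab : a.1 - b.1 = z.1)
    (t : torsion (I ⊔ J) (E.cocomplex.X (i + 1)))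
    (ha : t.1 = (E.cocomplex.d i (i + 1)).hom a.1)
    (hb : t.1 = (E.cocomplex.d i (i + 1)).hom b.1) :
    Represents (torsionComplex (I ⊔ J) E.cocomplex) (i + 1) t (mvDelta E I J i x) :=
  represents_δ (mvShortComplex_shortExact I J E.cocomplex E.injective) hx (a, b)
    (Subtype.ext hab) t (Prod.ext (Subtype.ext ha) (Subtype.ext hb))

/-- The connecting maps of the Mayer-Vietoris sequence come from `A_n(K)`-linear maps. -/
theorem exists_mvDelta_cohComparisonHom [CharZero K]
    (c : weylResComplex Q.cocomplex ⟶ E.cocomplex)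
    (I J : Ideal (MvPolynomial (Fin n) K)) (i : ℕ)
    (y : (weylTorsionComplex (I ⊓ J) Q.cocomplex).homology i) :
    ∃ y' : (weylTorsionComplex (I ⊔ J) Q.cocomplex).homology (i + 1), ∀ P : weylAlgebra K n,
      mvDelta E I J i (cohComparisonHom (I ⊓ J) c i (P • y)) =
        cohComparisonHom (I ⊔ J) c (i + 1) (P • y') := by
  obtain ⟨z, hz⟩ := exists_represents y
  -- The splitting exists because `Q^i` is injective over `R`. It is chosen before `P`, so that `P •
  -- a` and `P • b` split `P • z` for every `P`.
  obtain ⟨a, ha, b, hb, hab⟩ : ∃ a ∈ weylTorsion I (Q.cocomplex.X i),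
      ∃ b ∈ weylTorsion J (Q.cocomplex.X i), a - b = z.1 :=
    exists_sub_eq I J ((weylRes K n).obj (Q.cocomplex.X i)) z.2
  have hz0 : (Q.cocomplex.d i (i + 1)).hom z.1 = 0 :=
    congrArg Subtype.val (hz.d_eq_zero (i + 1))
  have hd : (Q.cocomplex.d i (i + 1)).hom a = (Q.cocomplex.d i (i + 1)).hom b := by
    rw [← sub_eq_zero, ← map_sub, hab, hz0]
  have ha1 : (Q.cocomplex.d i (i + 1)).hom a ∈ weylTorsion I (Q.cocomplex.X (i + 1)) :=
    (((weylTorsionComplex I Q.cocomplex).d i (i + 1)).hom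
      (⟨a, ha⟩ : weylTorsion I (Q.cocomplex.X i))).2
  have hb1 : (Q.cocomplex.d i (i + 1)).hom b ∈ weylTorsion J (Q.cocomplex.X (i + 1)) :=
    (((weylTorsionComplex J Q.cocomplex).d i (i + 1)).hom
      (⟨b, hb⟩ : weylTorsion J (Q.cocomplex.X i))).2
  -- Since `z` is a cocycle, `da = db` is both `I`-torsion and `J`-torsion, hence `(I + J)`-torsion.
  let t : weylTorsion (I ⊔ J) (Q.cocomplex.X (i + 1)) :=
    ⟨_, torsion_sup I J ((weylRes K n).obj (Q.cocomplex.X (i + 1))) ha1 (hd ▸ hb1)⟩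
  have ht : (Q.cocomplex.d (i + 1) (i + 2)).hom ((Q.cocomplex.d i (i + 1)).hom a) = 0 :=
    congrArg (fun f => f.hom a) (Q.cocomplex.d_comp_d i (i + 1) (i + 2))
  obtain ⟨y', hy'⟩ := exists_represents_of_d_eq_zero
    (C := weylTorsionComplex (I ⊔ J) Q.cocomplex) (z := t) (Subtype.ext ht)
  refine ⟨y', fun P => Represents.unique ?_ ((hy'.smul P).cohComparisonHom (I ⊔ J) c)⟩
  refine represents_mvDelta ((hz.smul P).cohComparisonHom (I ⊓ J) c)
    (torsionHom I c i ⟨P • a, (weylTorsion I _).smul_mem P ha⟩)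
    (torsionHom J c i ⟨P • b, (weylTorsion J _).smul_mem P hb⟩) ?_ _ ?_ ?_
  · exact (hom_smul_sub c i P a b).trans
      (congrArg (fun m : Q.cocomplex.X i => (c.f i).hom (P • m : Q.cocomplex.X i)) hab)
  · exact comm_smul c i P a
  · exact (congrArg (fun m : Q.cocomplex.X (i + 1) =>
      (c.f (i + 1)).hom (P • m : Q.cocomplex.X (i + 1))) hd).trans (comm_smul c i P b)

/-! ### Transport of the `A_n(K)`-module structure -/

/-- A module structure transported along a bijective additive map. -/
noncomputable abbrev moduleOfBijective {A M N : Type*} [Semiring A] [AddCommGroup M]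
    [AddCommGroup N] [Module A M] (f : M →+ N) (h : Function.Bijective f) : Module A N :=
  letI : SMul A N := ⟨fun P x => f (P • (h.2 x).choose)⟩
  Function.Surjective.module A f h.2 fun P y =>
    congrArg (fun m => f (P • m)) (h.1 (h.2 (f y)).choose_spec).symm

theorem moduleOfBijective_smul {A M N : Type*} [Semiring A] [AddCommGroup M] [AddCommGroup N]
    [Module A M] (f : M →+ N) (h : Function.Bijective f) (P : A) (y : M) :
    letI := moduleOfBijective (A := A) f h
    f (P • y) = P • f y :=
  congrArg (fun m => f (P • m)) (h.1 (h.2 (f y)).choose_spec).symm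

/-- One `y'` serves all `P`; the case `P = 1` identifies `p y` with `p' y'`, and equivariance of
`p'` gives the rest. No linear map `y ↦ y'` has to be constructed. -/
theorem map_smul_of_exists_lift {A M M' N : Type*} [Monoid A] [MulAction A M] [MulAction A M']
    [SMul A N] {p : M → N} {p' : M' → N} (hp' : ∀ (P : A) (y : M'), p' (P • y) = P • p' y) {y : M}
    (h : ∃ y', ∀ P : A, p (P • y) = p' (P • y')) (P : A) : p (P • y) = P • p y := by
  obtain ⟨y', hy'⟩ := h
  have h1 := hy' 1
  rw [one_smul, one_smul] at h1
  rw [hy', hp', h1]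

section Transport

variable [∀ (L : Ideal (MvPolynomial (Fin n) K)) (i : ℕ), Module (weylAlgebra K n) (localCoh L E i)]

theorem cohComparison_smul [CharZero K] {c : weylResComplex Q.cocomplex ⟶ E.cocomplex}
    (hc : IsComparison Q E c)
    (hs : ∀ (L : Ideal (MvPolynomial (Fin n) K)) (i : ℕ) (P : weylAlgebra K n)
      (y : (weylTorsionComplex L Q.cocomplex).homology i),
      cohComparisonHom L c i (P • y) = P • cohComparisonHom L c i y)
    {c' : weylResComplex Q'.cocomplex ⟶ E.cocomplex} (hc' : IsComparison Q' E c')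
    (L : Ideal (MvPolynomial (Fin n) K)) (i : ℕ) (P : weylAlgebra K n)
    (y : (weylTorsionComplex L Q'.cocomplex).homology i) :
    (cohComparison L c' i).hom (P • y : (weylTorsionComplex L Q'.cocomplex).homology i) =
      P • (cohComparison L c' i).hom y :=
  map_smul_of_exists_lift (p := cohComparisonHom L c' i) (hs L i)
    (exists_weyl_equivariant_comparison hc' hc L i y) P

theorem cohIncl_smul [CharZero K] {c : weylResComplex Q.cocomplex ⟶ E.cocomplex}
    (hc : IsComparison Q E c)
    (hs : ∀ (L : Ideal (MvPolynomial (Fin n) K)) (i : ℕ) (P : weylAlgebra K n)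
      (y : (weylTorsionComplex L Q.cocomplex).homology i),
      cohComparisonHom L c i (P • y) = P • cohComparisonHom L c i y)
    {L L' : Ideal (MvPolynomial (Fin n) K)} (h : L ≤ L') (i : ℕ) (P : weylAlgebra K n)
    (x : localCoh L' E i) : cohIncl E h i (P • x) = P • cohIncl E h i x := by
  obtain ⟨y, rfl⟩ : ∃ y, cohComparisonHom L' c i y = x := (cohComparison_bijective hc L' i).2 x
  rw [← hs]
  exact map_smul_of_exists_lift (p := fun y => cohIncl E h i (cohComparisonHom L' c i y)) (hs L i)
    (exists_cohIncl_cohComparisonHom c h i y) P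

theorem mvDelta_smul [CharZero K] {c : weylResComplex Q.cocomplex ⟶ E.cocomplex}
    (hc : IsComparison Q E c)
    (hs : ∀ (L : Ideal (MvPolynomial (Fin n) K)) (i : ℕ) (P : weylAlgebra K n)
      (y : (weylTorsionComplex L Q.cocomplex).homology i),
      cohComparisonHom L c i (P • y) = P • cohComparisonHom L c i y)
    (I J : Ideal (MvPolynomial (Fin n) K)) (i : ℕ) (P : weylAlgebra K n)
    (x : localCoh (I ⊓ J) E i) : mvDelta E I J i (P • x) = P • mvDelta E I J i x := by
  obtain ⟨y, rfl⟩ : ∃ y, cohComparisonHom (I ⊓ J) c i y = x :=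
    (cohComparison_bijective hc (I ⊓ J) i).2 x
  rw [← hs]
  exact map_smul_of_exists_lift
    (p := fun y => mvDelta E I J i (cohComparisonHom (I ⊓ J) c i y)) (hs (I ⊔ J) (i + 1))
    (exists_mvDelta_cohComparisonHom c I J i y) P

theorem mvPi_smul [CharZero K] {c : weylResComplex Q.cocomplex ⟶ E.cocomplex}
    (hc : IsComparison Q E c)
    (hs : ∀ (L : Ideal (MvPolynomial (Fin n) K)) (i : ℕ) (P : weylAlgebra K n)
      (y : (weylTorsionComplex L Q.cocomplex).homology i),
      cohComparisonHom L c i (P • y) = P • cohComparisonHom L c i y)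
    (I J : Ideal (MvPolynomial (Fin n) K)) (i : ℕ) (P : weylAlgebra K n)
    (x : localCoh I E i × localCoh J E i) : mvPi E I J i (P • x) = P • mvPi E I J i x := by
  have h (x : localCoh I E i × localCoh J E i) : mvPi E I J i x =
    cohIncl E inf_le_left i x.1 - cohIncl E inf_le_right i x.2 := rfl
  rw [h, h, Prod.smul_fst, Prod.smul_snd, cohIncl_smul hc hs, cohIncl_smul hc hs, smul_sub]

end Transport

end Comparison
end MVWeyl

theorem mainTheorem5 {K : Type u} [Field K] [CharZero K] (n : ℕ)
    (E : InjectiveResolution (MVWeyl.polyR K n)) :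
    ∃ mod : ∀ (L : Ideal (MvPolynomial (Fin n) K)) (i : ℕ),
        Module (MVWeyl.weylAlgebra K n) (MVWeyl.localCoh L E i),
      (∀ (L : Ideal (MvPolynomial (Fin n) K)) (i : ℕ) (r : MvPolynomial (Fin n) K)
        (x : MVWeyl.localCoh L E i), MVWeyl.toWeyl K n r • x = r • x) ∧
      (∀ Q : InjectiveResolution (MVWeyl.polyD K n),
        (∃ c, MVWeyl.IsComparison Q E c) ∧
        ∀ c, MVWeyl.IsComparison Q E c → ∀ (L : Ideal (MvPolynomial (Fin n) K)) (i : ℕ),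
          Function.Bijective (MVWeyl.cohComparison L c i) ∧
          ∀ (P : MVWeyl.weylAlgebra K n)
            (y : (MVWeyl.weylTorsionComplex L Q.cocomplex).homology i),
            (MVWeyl.cohComparison L c i).hom (P • y) =
              P • (MVWeyl.cohComparison L c i).hom y) ∧
      ∀ (I J : Ideal (MvPolynomial (Fin n) K)) (i : ℕ) (P : MVWeyl.weylAlgebra K n),
        (∀ x, MVWeyl.mvRho E I J i (P • x) = P • MVWeyl.mvRho E I J i x) ∧
        (∀ x, MVWeyl.mvPi E I J i (P • x) = P • MVWeyl.mvPi E I J i x) ∧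
        (∀ x, MVWeyl.mvDelta E I J i (P • x) = P • MVWeyl.mvDelta E I J i x) := by
  -- One auxiliary resolution defines the structure for all `L` and `i` at once; independence of
  -- this choice is part of the conclusion.
  let Q := InjectiveResolution.of (MVWeyl.polyD K n)
  obtain ⟨c, hc⟩ := MVWeyl.exists_isComparison Q E
  have hb (L : Ideal (MvPolynomial (Fin n) K)) (i : ℕ) :
      Function.Bijective (MVWeyl.cohComparisonHom L c i) := MVWeyl.cohComparison_bijective hc L i
  let mod (L : Ideal (MvPolynomial (Fin n) K)) (i : ℕ) :
      Module (MVWeyl.weylAlgebra K n) (MVWeyl.localCoh L E i) :=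
    MVWeyl.moduleOfBijective (MVWeyl.cohComparisonHom L c i) (hb L i)
  have hs (L : Ideal (MvPolynomial (Fin n) K)) (i : ℕ) (P : MVWeyl.weylAlgebra K n)
      (y : (MVWeyl.weylTorsionComplex L Q.cocomplex).homology i) :
      MVWeyl.cohComparisonHom L c i (P • y) = P • MVWeyl.cohComparisonHom L c i y :=
    MVWeyl.moduleOfBijective_smul (MVWeyl.cohComparisonHom L c i) (hb L i) P y
  refine ⟨mod, fun L i r x => ?_, fun Q' => ⟨MVWeyl.exists_isComparison Q' E,
    fun c' hc' L i => ⟨MVWeyl.cohComparison_bijective hc' L i,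
      MVWeyl.cohComparison_smul hc hs hc' L i⟩⟩,
    fun I J i P => ⟨fun x => ?_, MVWeyl.mvPi_smul hc hs I J i P,
      MVWeyl.mvDelta_smul hc hs I J i P⟩⟩
  · obtain ⟨y, rfl⟩ := (hb L i).2 x
    rw [← hs]
    exact MVWeyl.cohComparisonHom_toWeyl_smul L c i r y
  · exact Prod.ext (MVWeyl.cohIncl_smul hc hs _ i P x) (MVWeyl.cohIncl_smul hc hs _ i P x)
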